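/- Let $V^{5,2}=\mathrm{SO}(5)/\mathrm{SO}(3)$, with $\mathrm{SO}(3)$ the lower right block of $\mathrm{SO}(5)$. With $E_{ij}$ the elementary matrices put $e_1,\dots,e_4=E_{1k}-E_{k1}$ ($k=2,\dots,5$), $e_5,e_6,e_7=E_{2k}-E_{k2}$ ($k=3,4,5$), $e_8=E_{34}-E_{43}$, $e_9=E_{35}-E_{53}$, $e_{10}=E_{45}-E_{54}$, so that $\mathfrak{so}(3)=\langle e_8,e_9,e_{10}\rangle$ and $\mathfrak m=\mathfrak{so}(3)^\perp=\langle e_1,\dots,e_7\rangle$ is identified with the tangent space of $V^{5,2}$; $e^i$ is the dual basis, $e^{ij\dots}=e^i\wedge e^j\wedge\cdots$, and $Q(A,B)=\frac12\operatorname{tr}(AB^T)$. Let $\mathfrak m_1=\langle e_1\rangle$, $\mathfrak m_2=\langle e_2,e_3,e_4\rangle$, $\mathfrak m_3=\langle e_5,e_6,e_7\rangle$. For $(a,b,x,y,z)\in\mathbb R^5$ with $a^2+by>0$, $b^2+ax>0$, $z\ne0$, $xy=ab$, consider the $\mathrm{SO}(5)$-invariant $\mathrm G_2$-structure $$\varphi=-z\,e^1\wedge(e^{25}+e^{36}+e^{47})+x\,e^{234}+a(-e^{267}+e^{357}-e^{456})+b(e^{237}-e^{246}+e^{345})-y\,e^{567},$$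 which induces the metric $g=y_1Q|_{\mathfrak m_1}+y_2Q|_{\mathfrak m_2}+y_3Q|_{\mathfrak m_3}$ with $y_2=\frac{(b^2+ax)^{2/3}}{(a^2+by)^{1/3}}$, $y_3=\frac{(a^2+by)^{2/3}}{(b^2+ax)^{1/3}}$, $y_1=\frac{z^2}{y_2y_3}$, and let $\psi=*\varphi$. A connection $A$ is a $\mathrm G_2$-instanton if $F_A\wedge\psi=0$. It is a self-dual contact instanton (SDCI) if $*(\eta\wedge\omega\wedge F_A)=F_A$, where $\eta=\sqrt{y_1}\,e^1$, $\omega=\frac12d\eta$, and $*$ is the Hodge star of $g$ for the orientation $e^{1234567}$. The metric $g$ is Sasakian (with contact form $\eta$) exactly when $x=a$, $y=b$, $z^2=4(a^2+b^2)^{4/3}$. For a homomorphism $\phi:\mathrm{SO}(3)\to\mathrm{SO}(3)$ let $P_\phi=\mathrm{SO}(5)\times_\phi\mathrm{SO}(3)\to V^{5,2}$, with the left action of $\mathrm{SO}(5)$; put $P_1=P_{\mathrm{id}}$ and let $P_0=V^{5,2}\times\mathrm{SO}(3)$ be the bundle of the trivial homomorphism. Then: 1. The connection $\alpha=e^8\otimes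 e_8+e^9\otimes e_9+e^{10}\otimes e_{10}$ on $P_1$ is $\mathrm{SO}(5)$-invariant, with curvature $$F_\alpha=(e^{23}+e^{56})\otimes e_8+(e^{24}+e^{57})\otimes e_9+(e^{34}+e^{67})\otimes e_{10}.$$ For all $a,b,z$ with $a^2+b^2>0$ and $z^2=4(a^2+b^2)^{4/3}$, with respect to the $\mathrm G_2$-structure with parameters $(a,b,a,b,z)$ and its Sasakian metric, $\alpha$ satisfies $F_\alpha\wedge\psi=0$ and is an SDCI, and $\alpha$ is the unique $\mathrm{SO}(5)$-invariant connection on $P_1$ that is simultaneously a $\mathrm G_2$-instanton and an SDCI. 2. The $\mathrm{SO}(5)$-invariant connections on $P_0$ are the connections $\alpha=e^1\otimes(b_8e_8+b_9e_9+b_{10}e_{10})$ with $b_8,b_9,b_{10}\in\mathbb R$; the curvature is $F_\alpha=(e^{25}+e^{36}+e^{47})\otimes(b_8e_8+b_9e_9+b_{10}e_{10})$. For every $(a,b,x,y,z)$ as above (in particular for those with Sasakian metric), such a connection satisfies $F_\alpha\wedge\psi=0$ if and only if it is flat. -/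

import Mathlib

open Matrix

namespace Stiefel

noncomputable section

/-! ### The groups `SO(n)`, their Lie algebras, and `SO(3) ⊂ SO(5)` -/

/-- The Lie group `SO(n)` of real `n × n` matrices. -/
abbrev SO (n : ℕ) := Matrix.specialOrthogonalGroup (Fin n) ℝ

/-- The Lie algebra `𝔰𝔬(n)` of real skew-symmetric matrices. -/
abbrev so (n : ℕ) := LieAlgebra.Orthogonal.so (Fin n) ℝ

theorem SO.mul_transpose {n : ℕ} (g : SO n) : (g : Matrix (Fin n) (Fin n) ℝ) * g.1ᵀ = 1 :=
  (Matrix.mem_orthogonalGroup_iff (Fin n) ℝ).1 (Matrix.mem_specialOrthogonalGroup_iff.1 g.2).1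

theorem SO.transpose_mul {n : ℕ} (g : SO n) : g.1ᵀ * (g : Matrix (Fin n) (Fin n) ℝ) = 1 :=
  (Matrix.mem_orthogonalGroup_iff' (Fin n) ℝ).1 (Matrix.mem_specialOrthogonalGroup_iff.1 g.2).1

theorem SO.coe_inv {n : ℕ} (g : SO n) : ((g⁻¹ : SO n) : Matrix (Fin n) (Fin n) ℝ) = g.1ᵀ := rfl

/-- The adjoint representation `Ad(g) X = g X g⁻¹` of `SO(n)` on `𝔰𝔬(n)`. -/
def Ad {n : ℕ} (g : SO n) : so n →ₗ[ℝ] so n where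
  toFun X := ⟨g.1 * X.1 * g.1ᵀ, by
    have hX : X.1ᵀ = -X.1 := (LieAlgebra.Orthogonal.mem_so (Fin n) ℝ X.1).1 X.2
    rw [LieAlgebra.Orthogonal.mem_so]
    simp [Matrix.transpose_mul, hX, Matrix.mul_assoc]⟩
  map_add' X Y := by
    apply Subtype.ext
    simp [Matrix.mul_add, Matrix.add_mul]
  map_smul' c X := by
    apply Subtype.ext
    simp

/-- The matrix `E_{ij} - E_{ji}` as an element of `𝔰𝔬(n)` (indices start at `0`). -/
def skew {n : ℕ} (i j : Fin n) : so n :=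
  ⟨Matrix.single i j 1 - Matrix.single j i 1, by
    rw [LieAlgebra.Orthogonal.mem_so]
    simp [Matrix.transpose_sub, Matrix.transpose_single]⟩

/-- The exponential map `𝔰𝔬(n) → SO(n)`. -/
def expSO {n : ℕ} (X : so n) : SO n :=
  ⟨NormedSpace.exp X.1, by
    have key : ∀ Y : so n, NormedSpace.exp Y.1 ∈ Matrix.orthogonalGroup (Fin n) ℝ := by
      intro Y
      have hY : Y.1ᵀ = -Y.1 := (LieAlgebra.Orthogonal.mem_so (Fin n) ℝ Y.1).1 Y.2
      rw [Matrix.mem_orthogonalGroup_iff]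
      rw [← Matrix.exp_transpose, hY, ← Matrix.exp_add_of_commute _ _
        (Commute.neg_right (Commute.refl Y.1)), add_neg_cancel, NormedSpace.exp_zero]
    rw [Matrix.mem_specialOrthogonalGroup_iff]
    refine ⟨key X, ?_⟩
    have hsq : NormedSpace.exp X.1 =
        NormedSpace.exp ((1 / 2 : ℝ) • X).1 * NormedSpace.exp ((1 / 2 : ℝ) • X).1 := by
      rw [← Matrix.exp_add_of_commute _ _ (Commute.refl _)]
      congr 1
      have : ((1 / 2 : ℝ) • X).1 = (1 / 2 : ℝ) • X.1 := rfl
      rw [this, ← add_smul]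
      norm_num
    have h1 := (Matrix.mem_orthogonalGroup_iff (Fin n) ℝ).1 (key ((1 / 2 : ℝ) • X))
    have h2 := congrArg Matrix.det h1
    rw [Matrix.det_mul, Matrix.det_transpose, Matrix.det_one] at h2
    rw [hsq, Matrix.det_mul, h2]⟩

/-- The splitting of the five indices into the first two and the last three. -/
def blocks : Fin 2 ⊕ Fin 3 ≃ Fin 5 := finSumFinEquiv

theorem incl_mem (h : SO 3) :
    (Matrix.fromBlocks (1 : Matrix (Fin 2) (Fin 2) ℝ) 0 0 h.1).submatrix
      blocks.symm blocks.symm ∈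
      Matrix.specialOrthogonalGroup (Fin 5) ℝ := by
  rw [Matrix.mem_specialOrthogonalGroup_iff, Matrix.mem_orthogonalGroup_iff]
  have h1 : h.1 * h.1ᵀ = 1 := SO.mul_transpose h
  have h2 : h.1.det = 1 := (Matrix.mem_specialOrthogonalGroup_iff.1 h.2).2
  constructor
  · rw [Matrix.transpose_submatrix, Matrix.submatrix_mul_equiv, Matrix.fromBlocks_transpose,
      Matrix.fromBlocks_multiply]
    simp [h1]
  · rw [Matrix.det_submatrix_equiv_self, Matrix.det_fromBlocks_zero₂₁, h2]
    simp

/-- The isotropy group: `SO(3)` embedded in `SO(5)` as the lower right block, `h ↦ diag(I₂, h)`.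
The Stiefel manifold is `V^{5,2} = SO(5) / SO(3)` for this embedding. -/
def incl : SO 3 →* SO 5 where
  toFun h := ⟨_, incl_mem h⟩
  map_one' := by
    apply Subtype.ext
    simp
  map_mul' g h := by
    apply Subtype.ext
    simp only [Submonoid.coe_mul]
    rw [Matrix.submatrix_mul_equiv, Matrix.fromBlocks_multiply]
    simp

/-- The embedding `𝔰𝔬(3) ⊂ 𝔰𝔬(5)`, the derivative of `incl`. -/
def inclLie : so 3 →ₗ[ℝ] so 5 where
  toFun W := ⟨(Matrix.fromBlocks (0 : Matrix (Fin 2) (Fin 2) ℝ) 0 0 W.1).submatrix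
      blocks.symm blocks.symm, by
    have hW : W.1ᵀ = -W.1 := (LieAlgebra.Orthogonal.mem_so (Fin 3) ℝ W.1).1 W.2
    rw [LieAlgebra.Orthogonal.mem_so, Matrix.transpose_submatrix, Matrix.fromBlocks_transpose, hW]
    have h0 : (Matrix.fromBlocks 0 0 0 (-W.1) : Matrix (Fin 2 ⊕ Fin 3) (Fin 2 ⊕ Fin 3) ℝ) =
        -Matrix.fromBlocks 0 0 0 W.1 := by
      rw [Matrix.fromBlocks_neg]
      simp
    simp only [Matrix.transpose_zero]
    rw [h0]
    rfl⟩
  map_add' X Y := by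
    apply Subtype.ext
    have h0 : (Matrix.fromBlocks 0 0 0 (X.1 + Y.1) : Matrix (Fin 2 ⊕ Fin 3) (Fin 2 ⊕ Fin 3) ℝ) =
        Matrix.fromBlocks 0 0 0 X.1 + Matrix.fromBlocks 0 0 0 Y.1 := by
      rw [Matrix.fromBlocks_add]
      simp
    exact congrArg (fun M => Matrix.submatrix M blocks.symm blocks.symm) h0
  map_smul' c X := by
    apply Subtype.ext
    have h0 : (Matrix.fromBlocks 0 0 0 (c • X.1) : Matrix (Fin 2 ⊕ Fin 3) (Fin 2 ⊕ Fin 3) ℝ) =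
        c • Matrix.fromBlocks 0 0 0 X.1 := by
      rw [Matrix.fromBlocks_smul]
      simp
    exact congrArg (fun M => Matrix.submatrix M blocks.symm blocks.symm) h0

/-- The projection `𝔰𝔬(5) = 𝔪 ⊕ 𝔰𝔬(3) → 𝔰𝔬(3)` onto the lower right block. -/
def projLie : so 5 →ₗ[ℝ] so 3 where
  toFun X := ⟨X.1.submatrix (Fin.natAdd 2) (Fin.natAdd 2), by
    have hX : X.1ᵀ = -X.1 := (LieAlgebra.Orthogonal.mem_so (Fin 5) ℝ X.1).1 X.2
    rw [LieAlgebra.Orthogonal.mem_so, Matrix.transpose_submatrix, hX]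
    rfl⟩
  map_add' X Y := by
    apply Subtype.ext
    rfl
  map_smul' c X := by
    apply Subtype.ext
    rfl

/-- The basis `e₁, …, e₇` of `𝔪 = 𝔰𝔬(3)^⊥ ⊂ 𝔰𝔬(5)`; `frame i` is `e_{i+1}`. -/
def frame : Fin 7 → so 5 :=
  ![skew 0 1, skew 0 2, skew 0 3, skew 0 4, skew 1 2, skew 1 3, skew 1 4]

/-- The coordinates of the `𝔪`-component of an element of `𝔰𝔬(5) = 𝔪 ⊕ 𝔰𝔬(3)` in the basis
`e₁, …, e₇`. -/
def mCoord (X : so 5) : Fin 7 → ℝ :=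
  ![X.1 0 1, X.1 0 2, X.1 0 3, X.1 0 4, X.1 1 2, X.1 1 3, X.1 1 4]

/-! ### Homogeneous `SO(3)`-bundles over `V^{5,2}` and their connections

For a homomorphism `φ : SO(3) → SO(3)` the bundle `P_φ = SO(5) ×_φ SO(3)` is the quotient of
`SO(5) × SO(3)` by the action `(u, s) · r = (u r, φ(r)⁻¹ s)` of the isotropy group. Differential
forms on `P_φ` are the same thing as differential forms on `SO(5) × SO(3)` that are basic for this
action, that is, invariant and zero on vectors tangent to the orbits.
Tangent vectors of `SO(5) × SO(3)` at `(u, s)` are written `(u X, s Z)` with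
`(X, Z) ∈ 𝔰𝔬(5) × 𝔰𝔬(3)`. -/

/-- A real function on `SO(5) × SO(3)` is smooth: it is the restriction of a smooth function of the
matrix entries. -/
def IsSmooth (f : SO 5 → SO 3 → ℝ) : Prop :=
  ∃ F : (Fin 5 → Fin 5 → ℝ) × (Fin 3 → Fin 3 → ℝ) → ℝ,
    ContDiff ℝ (⊤ : ℕ∞) F ∧
      ∀ u s, f u s = F (fun i j => u.1 i j, fun i j => s.1 i j)

/-- `Z = φ_* W`: the curve `t ↦ φ (exp (t W))` has velocity `Z` at `t = 0`. -/
def IsVelocity (φ : SO 3 →* SO 3) (W Z : so 3) : Prop :=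
  ∀ i j, HasDerivAt (fun t : ℝ => (φ (expSO (t • W))).1 i j) (Z.1 i j) 0

/-- A (smooth) principal connection `A ∈ Ω¹(P_φ, 𝔰𝔬(3))` on the principal `SO(3)`-bundle
`P_φ = SO(5) ×_φ SO(3) → V^{5,2}`, given by its pullback to `SO(5) × SO(3)`:
`form u s (X, Z)` is the value of the pullback on the tangent vector `(u X, s Z)` at `(u, s)`. -/
@[ext]
structure Connection (φ : SO 3 →* SO 3) where
  form : SO 5 → SO 3 → (so 5 × so 3) →ₗ[ℝ] so 3
  smooth : ∀ ξ i j, IsSmooth (fun u s => (form u s ξ).1 i j)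
  /-- `A` reproduces the generators of the fundamental vector fields. -/
  vertical : ∀ u s Z, form u s (0, Z) = Z
  /-- `R_k^* A = Ad(k⁻¹) A` for the right action of the structure group. -/
  equivariant : ∀ u s (k : SO 3) X Z,
    form u (s * k) (X, Ad k⁻¹ Z) = Ad k⁻¹ (form u s (X, Z))
  /-- The pullback is invariant under the isotropy group. -/
  basic_invariant : ∀ u s (r : SO 3) X Z,
    form (u * incl r) ((φ r)⁻¹ * s) (Ad (incl r)⁻¹ X, Z) = form u s (X, Z)
  /-- The pullback vanishes on the tangent spaces of the orbits of the isotropy group. -/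
  basic_horizontal : ∀ u s W Z, IsVelocity φ W Z → form u s (inclLie W, -Ad s⁻¹ Z) = 0

namespace Connection

variable {φ : SO 3 →* SO 3}

/-- `L_v^* A = A` for all `v ∈ SO(5)`, where `L_v [(u, s)] = [(v u, s)]`. -/
def IsInvariant (A : Connection φ) : Prop :=
  ∀ (v u : SO 5) (s : SO 3), A.form (v * u) s = A.form u s

/-- The derivative of the `(i, j)` entry of `A(ζ)`, for the left-invariant vector field `ζ`, along
the left-invariant vector field `ξ`, at `(u, s)`. -/
def dirDeriv (A : Connection φ) (ξ ζ : so 5 × so 3) (u : SO 5) (s : SO 3) (i j : Fin 3) : ℝ :=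
  deriv (fun t : ℝ => (A.form (u * expSO (t • ξ.1)) (s * expSO (t • ξ.2)) ζ).1 i j) 0

/-- The curvature `F_A = dA + A ∧ A` (pulled back to `SO(5) × SO(3)`) at `(u, s)` on the vectors
`ξ, ζ`, where `dA(ξ, ζ) = ξ A(ζ) - ζ A(ξ) - A([ξ, ζ])` for left-invariant vector fields. -/
def curvature (A : Connection φ) (u : SO 5) (s : SO 3) (ξ ζ : so 5 × so 3) :
    Matrix (Fin 3) (Fin 3) ℝ :=
  Matrix.of (fun i j => A.dirDeriv ξ ζ u s i j - A.dirDeriv ζ ξ u s i j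
    - (A.form u s (⁅ξ.1, ζ.1⁆, ⁅ξ.2, ζ.2⁆)).1 i j)
  + ⁅(A.form u s ξ).1, (A.form u s ζ).1⁆

/-- `F_A = 0`. -/
def IsFlat (A : Connection φ) : Prop :=
  ∀ u s ξ ζ, A.curvature u s ξ ζ = 0

end Connection

theorem isSmooth_sum {ι : Type} (S : Finset ι) (f : ι → SO 5 → SO 3 → ℝ)
    (h : ∀ k ∈ S, IsSmooth (f k)) : IsSmooth (fun u s => ∑ k ∈ S, f k u s) := by
  choose! F hF hf using h
  exact ⟨fun p => ∑ k ∈ S, F k p, ContDiff.sum (fun k hk => hF k hk),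
    fun u s => Finset.sum_congr rfl (fun k hk => hf k hk u s)⟩

/-- The connection on `P_φ` with pullback `(u X, s Z) ↦ Ad(s⁻¹) (Λ X) + Z`, for a linear map
`Λ : 𝔰𝔬(5) → 𝔰𝔬(3)` that restricts to `φ_*` on `𝔰𝔬(3)` and is `SO(3)`-equivariant. -/
def linearConnection (φ : SO 3 →* SO 3) (Λ : so 5 →ₗ[ℝ] so 3)
    (h1 : ∀ W Z, IsVelocity φ W Z → Λ (inclLie W) = Z)
    (h2 : ∀ (r : SO 3) X, Λ (Ad (incl r) X) = Ad (φ r) (Λ X)) : Connection φ where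
  form u s := ((Ad s⁻¹).comp Λ).comp (LinearMap.fst ℝ (so 5) (so 3)) + LinearMap.snd ℝ _ _
  smooth := by
    intro ξ i j
    have hp : ∀ a b, IsSmooth (fun _ s => s.1 a i * (Λ ξ.1).1 a b * s.1 b j) := by
      intro a b
      refine ⟨fun p => p.2 a i * (Λ ξ.1).1 a b * p.2 b j, ?_, fun u s => rfl⟩
      fun_prop
    have hc : IsSmooth (fun _ _ => ξ.2.1 i j) :=
      ⟨fun _ => ξ.2.1 i j, contDiff_const, fun _ _ => rfl⟩
    obtain ⟨F, hF, hf⟩ := isSmooth_sum Finset.univ _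
      (fun b _ => isSmooth_sum Finset.univ _ (fun a _ => hp a b))
    obtain ⟨F', hF', hf'⟩ := hc
    refine ⟨fun p => F p + F' p, hF.add hF', fun u s => ?_⟩
    have e1 := hf u s
    have e2 := hf' u s
    show _ = F _ + F' _
    rw [← e1, ← e2]
    simp [Ad, SO.coe_inv, Matrix.mul_apply, Finset.sum_mul]
  vertical u s Z := by simp
  equivariant u s k X Z := by
    apply Subtype.ext
    simp [Ad, SO.coe_inv, Matrix.mul_add, Matrix.add_mul, Matrix.transpose_mul, Matrix.mul_assoc]
  basic_invariant u s r X Z := by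
    have hr := h2 r⁻¹ X
    rw [map_inv, map_inv] at hr
    have h3 : (φ r).1 * (φ r).1ᵀ = 1 := SO.mul_transpose _
    simp only [LinearMap.add_apply, LinearMap.comp_apply, LinearMap.fst_apply,
      LinearMap.snd_apply, hr]
    congr 1
    apply Subtype.ext
    simp only [Ad, SO.coe_inv, LinearMap.coe_mk, AddHom.coe_mk, Submonoid.coe_mul,
      Matrix.transpose_mul, Matrix.transpose_transpose, Matrix.mul_assoc]
    rw [← Matrix.mul_assoc (φ r).1 (φ r).1ᵀ s.1, h3, Matrix.one_mul,
      ← Matrix.mul_assoc (φ r).1 (φ r).1ᵀ, h3, Matrix.one_mul]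
  basic_horizontal u s W Z h := by
    simp [h1 W Z h]

theorem projLie_inclLie (W : so 3) : projLie (inclLie W) = W := by
  apply Subtype.ext
  ext i j
  have : ∀ k : Fin 3, blocks.symm (Fin.natAdd 2 k) = Sum.inr k :=
    fun k => finSumFinEquiv_symm_apply_natAdd k
  simp [projLie, inclLie, this]

theorem incl_apply (r : SO 3) :
    (incl r).1 = !![1, 0, 0, 0, 0; 0, 1, 0, 0, 0; 0, 0, r.1 0 0, r.1 0 1, r.1 0 2;
      0, 0, r.1 1 0, r.1 1 1, r.1 1 2; 0, 0, r.1 2 0, r.1 2 1, r.1 2 2] := by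
  ext i j
  fin_cases i <;> fin_cases j <;> rfl

theorem projLie_Ad (r : SO 3) (X : so 5) : projLie (Ad (incl r) X) = Ad r (projLie X) := by
  apply Subtype.ext
  ext i j
  simp only [projLie, Ad, LinearMap.coe_mk, AddHom.coe_mk, Matrix.submatrix_apply,
    Matrix.mul_apply, Matrix.transpose_apply, Fin.sum_univ_five, Fin.sum_univ_three]
  rw [incl_apply]
  fin_cases i <;> fin_cases j <;> simp

theorem Ad_apply_zero_one (r : SO 3) (X : so 5) : (Ad (incl r) X).1 0 1 = X.1 0 1 := by
  simp only [Ad, LinearMap.coe_mk, AddHom.coe_mk,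
    Matrix.mul_apply, Matrix.transpose_apply, Fin.sum_univ_five]
  rw [incl_apply]
  simp

theorem isVelocity_id (W : so 3) : IsVelocity (MonoidHom.id _) W W := by
  let _ : NormedRing (Matrix (Fin 3) (Fin 3) ℝ) := Matrix.linftyOpNormedRing
  let _ : NormedAlgebra ℝ (Matrix (Fin 3) (Fin 3) ℝ) := Matrix.linftyOpNormedAlgebra
  intro i j
  have h := hasDerivAt_exp_smul_const (𝕂 := ℝ) W.1 0
  rw [zero_smul, NormedSpace.exp_zero, one_mul] at h
  let L : Matrix (Fin 3) (Fin 3) ℝ →L[ℝ] ℝ :=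
    LinearMap.toContinuousLinearMap (Matrix.entryLinearMap ℝ ℝ i j)
  exact L.hasFDerivAt.comp_hasDerivAt 0 h

/-- The trivial homomorphism; `P₀ = P_{φ₀}` is the trivial bundle `V^{5,2} × SO(3)`. -/
abbrev phi0 : SO 3 →* SO 3 := 1

/-- The identity homomorphism; it defines the bundle `P₁ = P_{φ₁}`. -/
abbrev phi1 : SO 3 →* SO 3 := MonoidHom.id (SO 3)

/-- The connection `α = e⁸ ⊗ e₈ + e⁹ ⊗ e₉ + e¹⁰ ⊗ e₁₀` on `P₁`, i.e. the one given by the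
projection `𝔰𝔬(5) → 𝔰𝔬(3)`. -/
def canonicalConnection : Connection phi1 :=
  linearConnection phi1 projLie
    (fun W Z h => by
      rw [projLie_inclLie]
      apply Subtype.ext
      ext i j
      exact (isVelocity_id W i j).unique (h i j))
    projLie_Ad

/-- The linear form `e¹` on `𝔰𝔬(5)`. -/
def coord1 : so 5 →ₗ[ℝ] ℝ where
  toFun X := X.1 0 1
  map_add' _ _ := rfl
  map_smul' _ _ := rfl

/-- The basis `e₈, e₉, e₁₀` of `𝔰𝔬(3)`, seen in `3 × 3` matrices. -/
def soBasis : Fin 3 → so 3 := ![skew 0 1, skew 0 2, skew 1 2]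

/-- The connection `α = e¹ ⊗ (b₈ e₈ + b₉ e₉ + b₁₀ e₁₀)` on the trivial bundle `P₀`. -/
def trivialConnection (b : Fin 3 → ℝ) : Connection phi0 :=
  linearConnection phi0 (coord1.smulRight (∑ k, b k • soBasis k))
    (fun W Z h => by
      have hZ : Z = 0 := by
        apply Subtype.ext
        ext i j
        have h0 := (hasDerivAt_const (0 : ℝ) ((1 : SO 3).1 i j)).unique (h i j)
        simpa using h0.symm
      have : coord1 (inclLie W) = 0 := rfl
      rw [LinearMap.smulRight_apply, this, zero_smul, hZ])
    (fun r X => by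
      have : coord1 (Ad (incl r) X) = coord1 X := Ad_apply_zero_one r X
      rw [LinearMap.smulRight_apply, LinearMap.smulRight_apply, this]
      apply Subtype.ext
      simp [Ad])

/-! ### Forms at a point of `V^{5,2}`

The tangent space of `V^{5,2}` at `u SO(3)` is identified with `𝔪` through `X ↦ d/dt (u exp(tX))`,
and `𝔪* = ℝ⁷` by the basis `e¹, …, e⁷` dual to `e₁, …, e₇`. -/

/-- The exterior algebra `Λ 𝔪*`. -/
abbrev Form := ExteriorAlgebra ℝ (Fin 7 → ℝ)

/-- The covector `e^n`, for `n = 1, …, 7`. -/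
def e (n : ℕ) : Form :=
  ExteriorAlgebra.ι ℝ (fun k : Fin 7 => if (k : ℕ) + 1 = n then 1 else 0)

/-- The `2`-form with `B(e_p, e_q) = B p q`, for an alternating array `B`. -/
def twoForm (B : Fin 7 → Fin 7 → ℝ) : Form :=
  ∑ p : Fin 7, ∑ q ∈ Finset.Ioi p, B p q • (e ((p : ℕ) + 1) * e ((q : ℕ) + 1))

/-- The `(i, j)` entry of the curvature at `(u, s)` as a `2`-form on `V^{5,2}` at `u SO(3)`. The
curvature vanishes on vectors tangent to the fibres of `SO(5) × SO(3) → V^{5,2}`, so it is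
determined by its values on the lifts `(X, 0)`, `X ∈ 𝔪`, of the tangent vectors of `V^{5,2}`. -/
def Connection.curvatureForm {φ : SO 3 →* SO 3} (A : Connection φ) (u : SO 5) (s : SO 3)
    (i j : Fin 3) : Form :=
  twoForm (fun p q => A.curvature u s (frame p, 0) (frame q, 0) i j)

/-- The `SO(5)`-invariant `1`-form on `V^{5,2}` with components `c` in `e¹, …, e⁷`. -/
def oneForm (c : Fin 7 → ℝ) : Form := ExteriorAlgebra.ι ℝ c

/-- The exterior derivative of the invariant `1`-form `oneForm c`, by
`dη(X, Y) = -η([X, Y])` for `X, Y ∈ 𝔪`. -/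
def dOneForm (c : Fin 7 → ℝ) : Form :=
  twoForm (fun p q => -∑ k, c k * mCoord ⁅frame p, frame q⁆ k)

/-- The weights of the metric `g = y₁ Q|𝔪₁ + y₂ Q|𝔪₂ + y₃ Q|𝔪₃`, `Q(X, Y) = ½ tr(X Yᵀ)`, for which
`e₁, …, e₇` are orthogonal with `g(e_i, e_i)` as listed. -/
def weights (y₁ y₂ y₃ : ℝ) : Fin 7 → ℝ := ![y₁, y₂, y₂, y₂, y₃, y₃, y₃]

/-- The vector `a^♯` metrically dual to a covector `a`, as a linear form on covectors:
`b ↦ ⟨a, b⟩ = ∑ a_i b_i / w_i`. -/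
def sharp (w : Fin 7 → ℝ) : (Fin 7 → ℝ) →ₗ[ℝ] Module.Dual ℝ (Fin 7 → ℝ) :=
  Matrix.toBilin' (Matrix.diagonal fun i => (w i)⁻¹)

/-- The Riemannian volume form of `g` for the orientation given by `e¹ ∧ … ∧ e⁷`. -/
def volForm (w : Fin 7 → ℝ) : Form :=
  √(∏ i, w i) • (e 1 * e 2 * e 3 * e 4 * e 5 * e 6 * e 7)

/-- The Hodge star of the metric with weights `w` and the volume form `vol`:
`*(a₁ ∧ … ∧ a_k) = a_k^♯ ⌟ ⋯ a₂^♯ ⌟ a₁^♯ ⌟ vol`, which is the operator determined by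
`α ∧ *β = ⟨α, β⟩ vol`. -/
def hodgeStar (w : Fin 7 → ℝ) (vol α : Form) : Form :=
  ExteriorAlgebra.lift ℝ (A := Module.End ℝ Form)
    ⟨CliffordAlgebra.contractLeft.comp (sharp w), fun a => by
      refine LinearMap.ext fun x => ?_
      exact CliffordAlgebra.contractLeft_contractLeft (Q := 0) (sharp w a) x⟩
    (CliffordAlgebra.reverse α) vol

/-! ### Invariant `G₂`-structures and the instanton equations -/

/-- The condition `a² + by > 0`, `b² + ax > 0`, `z ≠ 0`, `xy = ab` on the parameters. -/
def IsG2Param (a b x y z : ℝ) : Prop :=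
  0 < a ^ 2 + b * y ∧ 0 < b ^ 2 + a * x ∧ z ≠ 0 ∧ x * y = a * b

/-- The invariant `G₂`-structure
`φ = -z e¹ ∧ (e²⁵ + e³⁶ + e⁴⁷) + x e²³⁴ + a (-e²⁶⁷ + e³⁵⁷ - e⁴⁵⁶) + b (e²³⁷ - e²⁴⁶ + e³⁴⁵) - y e⁵⁶⁷`. -/
def g2Form (a b x y z : ℝ) : Form :=
  -z • (e 1 * (e 2 * e 5 + e 3 * e 6 + e 4 * e 7)) + x • (e 2 * e 3 * e 4)
    + a • (-(e 2 * e 6 * e 7) + e 3 * e 5 * e 7 - e 4 * e 5 * e 6)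
    + b • (e 2 * e 3 * e 7 - e 2 * e 4 * e 6 + e 3 * e 4 * e 5) - y • (e 5 * e 6 * e 7)

/-- The coefficient `y₂ = (b² + ax)^{2/3} / (a² + by)^{1/3}` of the metric induced by the
`G₂`-structure. -/
def metricY2 (a b x y : ℝ) : ℝ :=
  (b ^ 2 + a * x) ^ (2 / 3 : ℝ) / (a ^ 2 + b * y) ^ (1 / 3 : ℝ)

/-- The coefficient `y₃ = (a² + by)^{2/3} / (b² + ax)^{1/3}`. -/
def metricY3 (a b x y : ℝ) : ℝ :=
  (a ^ 2 + b * y) ^ (2 / 3 : ℝ) / (b ^ 2 + a * x) ^ (1 / 3 : ℝ)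

/-- The coefficient `y₁ = z² / (y₂ y₃)`. -/
def metricY1 (a b x y z : ℝ) : ℝ := z ^ 2 / (metricY2 a b x y * metricY3 a b x y)

/-- The metric `g_φ` induced by the `G₂`-structure `φ = g2Form a b x y z`. -/
def g2Weights (a b x y z : ℝ) : Fin 7 → ℝ :=
  weights (metricY1 a b x y z) (metricY2 a b x y) (metricY3 a b x y)

/-- The `4`-form `ψ = *φ`, the star being that of the metric and the orientation induced by `φ`
(the orientation is `e¹ ∧ … ∧ e⁷` for `z > 0` and the opposite one for `z < 0`). -/
def g2Dual (a b x y z : ℝ) : Form :=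
  hodgeStar (g2Weights a b x y z) (Real.sign z • volForm (g2Weights a b x y z))
    (g2Form a b x y z)

namespace Connection

variable {φ : SO 3 →* SO 3}

/-- The `G₂`-instanton equation `F_A ∧ ψ = 0`. -/
def IsG2Instanton (A : Connection φ) (a b x y z : ℝ) : Prop :=
  ∀ u s i j, A.curvatureForm u s i j * g2Dual a b x y z = 0

/-- The equation `*(η ∧ ω ∧ F_A) = F_A` of self-dual contact instantons, for `η = X¹ = √y₁ e¹`,
`ω = ½ dη`, and the Hodge star of the metric `g = y₁ Q|𝔪₁ + y₂ Q|𝔪₂ + y₃ Q|𝔪₃` and the orientation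
`e¹ ∧ … ∧ e⁷`. -/
def IsSDCI (A : Connection φ) (y₁ y₂ y₃ : ℝ) : Prop :=
  ∀ u s i j,
    hodgeStar (weights y₁ y₂ y₃) (volForm (weights y₁ y₂ y₃))
      (oneForm (Pi.single 0 √y₁) * ((1 / 2 : ℝ) • dOneForm (Pi.single 0 √y₁))
        * A.curvatureForm u s i j)
      = A.curvatureForm u s i j

end Connection

end

end Stiefel

namespace Stiefel

noncomputable section

/-! ### Invariant connections -/

/-! By Wang's theorem an invariant connection on P_φ amounts to a linear map Λ : 𝔰𝔬(5) → 𝔰𝔬(3) that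
is SO(3)-equivariant and extends φ_*. Up to Ad(s⁻¹), its curvature on 𝔪 is [ΛX, ΛY] - Λ[X, Y]
(`Connection.IsInvariant.eq_linearConnection`, `linearConnection_curvature`). Under the isotropy
group, 𝔪 is the trivial line ⟨e₁⟩ plus two copies of the standard representation, which ad e₁
interchanges up to sign.

On P₀ the group acts trivially on the target, so Λ kills both copies and only T = Λ(e₁) remains,
with curvature (e²⁵ + e³⁶ + e⁴⁷) ⊗ T. The part of ψ without e¹ is a nonzero multiple of the square
of this 2-form, and the other terms of ψ are killed by it. So F ∧ ψ is a nonzero multiple of e²³⁴⁵⁶⁷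
⊗ T, and vanishes only for T = 0.

On P₁, Λ(e₁) is fixed by SO(3), hence zero. The self-duality equation makes F the star of a multiple
of e¹, so e₁ ⌟ F = 0, that is, Λ[e₁, X] = 0. As ad e₁ is invertible on 𝔪₂ ⊕ 𝔪₃, Λ vanishes on 𝔪 and
the connection is canonical. Conversely, the canonical curvature consists of primitive (1,1)-forms
for the complex structure pairing e₂, e₃, e₄ with e₅, e₆, e₇; this is the reason for both equations,
which are checked in coordinates. The Sasakian scaling y₂ = y₃, y₁ = 4y₂² makes the eigenvalue of
the star operator equal to 1. -/

theorem coe_lie {n : ℕ} (X Y : so n) : (⁅X, Y⁆ : so n).1 = X.1 * Y.1 - Y.1 * X.1 := rfl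

theorem coe_Ad {n : ℕ} (g : SO n) (X : so n) : (Ad g X).1 = g.1 * X.1 * g.1ᵀ := rfl

theorem Ad_mul {n : ℕ} (g h : SO n) (X : so n) : Ad (g * h) X = Ad g (Ad h X) := by
  apply Subtype.ext
  simp [coe_Ad, Matrix.transpose_mul, Matrix.mul_assoc]

theorem Ad_one {n : ℕ} (X : so n) : Ad (1 : SO n) X = X := by
  apply Subtype.ext
  simp [coe_Ad]

theorem Ad_inv_Ad {n : ℕ} (g : SO n) (X : so n) : Ad g⁻¹ (Ad g X) = X := by
  rw [← Ad_mul, inv_mul_cancel, Ad_one]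

theorem Ad_lie {n : ℕ} (g : SO n) (X Y : so n) : Ad g ⁅X, Y⁆ = ⁅Ad g X, Ad g Y⁆ := by
  apply Subtype.ext
  have h := SO.transpose_mul g
  have key : ∀ M N : Matrix (Fin n) (Fin n) ℝ,
      g.1 * M * g.1ᵀ * (g.1 * N * g.1ᵀ) = g.1 * (M * N) * g.1ᵀ := fun M N => by
    calc _ = g.1 * M * (g.1ᵀ * g.1) * N * g.1ᵀ := by simp only [Matrix.mul_assoc]
      _ = _ := by rw [h]; simp only [Matrix.mul_assoc, Matrix.one_mul]
  simp only [coe_lie, coe_Ad, key, Matrix.mul_sub, Matrix.sub_mul]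

theorem expSO_zero {n : ℕ} : expSO (0 : so n) = 1 :=
  Subtype.ext NormedSpace.exp_zero

theorem linearConnection_form (φ : SO 3 →* SO 3) (Λ : so 5 →ₗ[ℝ] so 3) (h1 h2)
    (u : SO 5) (s : SO 3) (X : so 5) (Z : so 3) :
    (linearConnection φ Λ h1 h2).form u s (X, Z) = Ad s⁻¹ (Λ X) + Z := rfl

theorem linearConnection_isInvariant (φ : SO 3 →* SO 3) (Λ : so 5 →ₗ[ℝ] so 3) (h1 h2) :
    (linearConnection φ Λ h1 h2).IsInvariant := fun _ _ _ => rfl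

/-- The form is independent of `u`, and the vectors have no component along `s`, so both derivatives
in dA are of constant functions; only the bracket terms remain. -/
theorem linearConnection_curvature (φ : SO 3 →* SO 3) (Λ : so 5 →ₗ[ℝ] so 3) (h1 h2)
    (u : SO 5) (s : SO 3) (X Y : so 5) :
    (linearConnection φ Λ h1 h2).curvature u s (X, 0) (Y, 0) =
      (Ad s⁻¹ (⁅Λ X, Λ Y⁆ - Λ ⁅X, Y⁆)).1 := by
  rw [map_sub, Ad_lie]
  ext i j
  simp [Connection.curvature, Connection.dirDeriv, linearConnection_form, expSO_zero,
    Ring.lie_def]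
  ring

/-- The linear map `𝔰𝔬(5) → 𝔰𝔬(3)` underlying a connection. -/
def Connection.linearPart {φ : SO 3 →* SO 3} (A : Connection φ) : so 5 →ₗ[ℝ] so 3 :=
  (A.form 1 1).comp (LinearMap.inl ℝ (so 5) (so 3))

namespace Connection

variable {φ : SO 3 →* SO 3} {A : Connection φ}

theorem IsInvariant.form_eq (hA : A.IsInvariant) (u : SO 5) (s : SO 3) (X : so 5) (Z : so 3) :
    A.form u s (X, Z) = Ad s⁻¹ (A.linearPart X) + Z := by
  have h0 : A.form u s (X, 0) = Ad s⁻¹ (A.linearPart X) := by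
    -- Equivariance moves `s` to 1, and invariance moves `u` to 1.
    have h1 := A.equivariant u 1 s X 0
    have h2 := hA u 1 1
    rw [mul_one] at h2
    rw [one_mul, map_zero, h2] at h1
    exact h1
  have h3 : ((X, Z) : so 5 × so 3) = (X, 0) + (0, Z) := by simp
  rw [h3, map_add, h0, A.vertical]

theorem IsInvariant.linearPart_inclLie (hA : A.IsInvariant) (W Z : so 3)
    (h : IsVelocity φ W Z) : A.linearPart (inclLie W) = Z := by
  have h1 := A.basic_horizontal 1 1 W Z h
  rw [hA.form_eq] at h1
  simpa [Ad_one, add_neg_eq_zero] using h1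

theorem IsInvariant.linearPart_Ad (hA : A.IsInvariant) (r : SO 3) (X : so 5) :
    A.linearPart (Ad (incl r) X) = Ad (φ r) (A.linearPart X) := by
  have h1 := A.basic_invariant 1 1 r (Ad (incl r) X) 0
  rw [hA.form_eq, hA.form_eq, Ad_inv_Ad] at h1
  simpa [Ad_one] using h1.symm

/-- Wang's theorem: the two basic conditions, read at the identity, are exactly the two hypotheses
on Λ. -/
theorem IsInvariant.eq_linearConnection (hA : A.IsInvariant) :
    A = linearConnection φ A.linearPart hA.linearPart_inclLie hA.linearPart_Ad := by
  apply Connection.ext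
  funext u s
  refine LinearMap.ext fun ⟨X, Z⟩ => ?_
  rw [hA.form_eq, linearConnection_form]

theorem IsInvariant.curvature_eq (hA : A.IsInvariant) (u : SO 5) (s : SO 3) (X Y : so 5) :
    A.curvature u s (X, 0) (Y, 0) =
      (Ad s⁻¹ (⁅A.linearPart X, A.linearPart Y⁆ - A.linearPart ⁅X, Y⁆)).1 := by
  conv_lhs => rw [hA.eq_linearConnection]
  exact linearConnection_curvature ..

end Connection

/-! ### Brackets -/

theorem single_mul_single_ite {n : ℕ} (i j k l : Fin n) :
    (Matrix.single i j (1 : ℝ)) * Matrix.single k l 1 =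
      if j = k then Matrix.single i l 1 else 0 := by
  split_ifs with h
  · subst h; simp
  · exact Matrix.single_mul_single_of_ne _ _ _ _ h _

theorem lie_skew_skew {n : ℕ} (i j k l : Fin n) :
    ⁅(skew i j : so n), skew k l⁆ =
      (if j = k then skew i l else 0) - (if j = l then skew i k else 0)
        - (if i = k then skew j l else 0) + (if i = l then skew j k else 0) := by
  apply Subtype.ext
  rw [coe_lie]
  simp only [skew, Matrix.mul_sub, Matrix.sub_mul, single_mul_single_ite, eq_comm (a := l),
    eq_comm (a := k)]
  split_ifs <;> simp <;> abel

theorem skew_apply {n : ℕ} (i j k l : Fin n) :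
    (skew i j : so n).1 k l = (if i = k ∧ j = l then 1 else 0) - if j = k ∧ i = l then 1 else 0 := by
  simp [skew, Matrix.single_apply]

theorem projLie_skew (i j : Fin 3) :
    projLie (skew (Fin.natAdd 2 i) (Fin.natAdd 2 j)) = skew i j := by
  apply Subtype.ext
  ext k l
  change (skew (Fin.natAdd 2 i) (Fin.natAdd 2 j)).1 (Fin.natAdd 2 k) (Fin.natAdd 2 l) = _
  simp [skew_apply, (Fin.natAdd_injective 3 2).eq_iff]

theorem projLie_frame (p : Fin 7) : projLie (frame p) = 0 := by
  apply Subtype.ext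
  ext k l
  change (frame p).1 (Fin.natAdd 2 k) (Fin.natAdd 2 l) = 0
  fin_cases p <;> fin_cases k <;> fin_cases l <;> simp [frame, skew_apply]

theorem so_apply_swap {n : ℕ} (X : so n) (i j : Fin n) : X.1 j i = -X.1 i j :=
  congrFun (congrFun ((LieAlgebra.Orthogonal.mem_so (Fin n) ℝ X.1).1 X.2) i) j

theorem so_apply_self {n : ℕ} (X : so n) (i : Fin n) : X.1 i i = 0 :=
  self_eq_neg.1 (so_apply_swap X i i)

theorem inclLie_apply (W : so 3) :
    (inclLie W).1 = !![0, 0, 0, 0, 0; 0, 0, 0, 0, 0; 0, 0, W.1 0 0, W.1 0 1, W.1 0 2;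
      0, 0, W.1 1 0, W.1 1 1, W.1 1 2; 0, 0, W.1 2 0, W.1 2 1, W.1 2 2] := by
  ext i j
  fin_cases i <;> fin_cases j <;> rfl

theorem so_ext_five {X Y : so 5} (h : ∀ p, mCoord X p = mCoord Y p)
    (h' : projLie X = projLie Y) : X = Y := by
  apply Subtype.ext
  have hp : ∀ k l : Fin 3, X.1 (Fin.natAdd 2 k) (Fin.natAdd 2 l) =
      Y.1 (Fin.natAdd 2 k) (Fin.natAdd 2 l) := fun k l => by
    have := congrArg (fun W : so 3 => W.1 k l) h'
    exact this
  have hu : ∀ i j : Fin 5, i < j → X.1 i j = Y.1 i j := by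
    intro i j hij
    fin_cases i <;> fin_cases j <;>
      first
      | exact absurd hij (by decide)
      | exact h 0
      | exact h 1
      | exact h 2
      | exact h 3
      | exact h 4
      | exact h 5
      | exact h 6
      | exact hp 0 1
      | exact hp 0 2
      | exact hp 1 2
  ext i j
  rcases lt_trichotomy i j with hij | rfl | hij
  · exact hu i j hij
  · rw [so_apply_self, so_apply_self]
  · rw [so_apply_swap X j i, so_apply_swap Y j i, hu j i hij]

/-- The `(i, j)` entry as a linear form on `𝔰𝔬(n)`. -/
def entry {n : ℕ} (i j : Fin n) : so n →ₗ[ℝ] ℝ where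
  toFun X := X.1 i j
  map_add' _ _ := rfl
  map_smul' _ _ := rfl

theorem coe_sum {n : ℕ} {ι : Type*} (S : Finset ι) (f : ι → so n) (i j : Fin n) :
    (∑ k ∈ S, f k).1 i j = ∑ k ∈ S, (f k).1 i j :=
  map_sum (entry i j) f S

/-- The reductive splitting: since Λ is prescribed on 𝔰𝔬(3), it is determined by its values on the
frame of 𝔪. -/
theorem eq_sum_mCoord_add_inclLie (X : so 5) : X = ∑ p, mCoord X p • frame p + inclLie (projLie X) := by
  apply so_ext_five
  · intro p
    fin_cases p <;>
      simp [mCoord, Fin.sum_univ_seven, frame, skew_apply, inclLie_apply]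
  · rw [map_add, map_sum, projLie_inclLie]
    simp [projLie_frame]

theorem so_three_eq_sum (W : so 3) :
    W = ∑ k, (![W.1 0 1, W.1 0 2, W.1 1 2] : Fin 3 → ℝ) k • soBasis k := by
  apply Subtype.ext
  ext i j
  rw [coe_sum]
  change _ = ∑ k, (![W.1 0 1, W.1 0 2, W.1 1 2] : Fin 3 → ℝ) k * (soBasis k).1 i j
  fin_cases i <;> fin_cases j <;>
    simp [Fin.sum_univ_three, soBasis, skew_apply, so_apply_self, so_apply_swap W 0 1,
      so_apply_swap W 0 2, so_apply_swap W 1 2]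

/-! ### Computations in the exterior algebra -/

theorem e_mul_self (n : ℕ) : e n * e n = 0 := ExteriorAlgebra.ι_sq_zero _

theorem e_mul_self_mul (n : ℕ) (x : Form) : e n * (e n * x) = 0 := by
  rw [← mul_assoc, e_mul_self, zero_mul]

/-- The condition `m < n` orients the rule, so that `simp` sorts monomials into increasing order and
stops. -/
theorem e_mul_swap {m n : ℕ} (_h : m < n) : e n * e m = -(e m * e n) :=
  eq_neg_of_add_eq_zero_left (ExteriorAlgebra.ι_add_mul_swap _ _)

theorem e_mul_swap_mul {m n : ℕ} (h : m < n) (x : Form) :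
    e n * (e m * x) = -(e m * (e n * x)) := by
  rw [← mul_assoc, e_mul_swap h, neg_mul, mul_assoc]

/-- The contraction with the vector metrically dual to `e^n`. -/
def contr (w : Fin 7 → ℝ) (n : ℕ) : Form →ₗ[ℝ] Form :=
  CliffordAlgebra.contractLeft (sharp w (fun k : Fin 7 => if (k : ℕ) + 1 = n then 1 else 0))

/-- The inner product of `e^n` and `e^m`. -/
def inner (w : Fin 7 → ℝ) (n m : ℕ) : ℝ :=
  ∑ k : Fin 7, if (k : ℕ) + 1 = n ∧ (k : ℕ) + 1 = m then (w k)⁻¹ else 0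

theorem contr_e_mul (w : Fin 7 → ℝ) (n m : ℕ) (x : Form) :
    contr w n (e m * x) = inner w n m • x - e m * contr w n x := by
  unfold contr e
  refine (CliffordAlgebra.contractLeft_ι_mul _ _ _).trans ?_
  congr 2
  simp [sharp, Matrix.toBilin'_apply', dotProduct, Matrix.mulVec_diagonal, inner, ← ite_and,
    and_comm]

theorem contr_one (w : Fin 7 → ℝ) (n : ℕ) : contr w n 1 = 0 :=
  CliffordAlgebra.contractLeft_one _ _

theorem contr_e (w : Fin 7 → ℝ) (n m : ℕ) : contr w n (e m) = inner w n m • 1 := by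
  simpa [contr_one] using contr_e_mul w n m 1

theorem inner_ne (w : Fin 7 → ℝ) {n m : ℕ} (h : n ≠ m) : inner w n m = 0 := by
  refine Finset.sum_eq_zero fun k _ => if_neg ?_
  omega

theorem inner_self (w : Fin 7 → ℝ) (k : Fin 7) : inner w (k + 1) (k + 1) = (w k)⁻¹ := by
  rw [inner, Finset.sum_eq_single k]
  · simp
  · intro j _ hj
    refine if_neg fun h => hj (Fin.ext ?_)
    omega
  · simp

theorem inner_one (w : Fin 7 → ℝ) : inner w 1 1 = (w 0)⁻¹ := inner_self w 0
theorem inner_two (w : Fin 7 → ℝ) : inner w 2 2 = (w 1)⁻¹ := inner_self w 1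
theorem inner_three (w : Fin 7 → ℝ) : inner w 3 3 = (w 2)⁻¹ := inner_self w 2
theorem inner_four (w : Fin 7 → ℝ) : inner w 4 4 = (w 3)⁻¹ := inner_self w 3
theorem inner_five (w : Fin 7 → ℝ) : inner w 5 5 = (w 4)⁻¹ := inner_self w 4
theorem inner_six (w : Fin 7 → ℝ) : inner w 6 6 = (w 5)⁻¹ := inner_self w 5
theorem inner_seven (w : Fin 7 → ℝ) : inner w 7 7 = (w 6)⁻¹ := inner_self w 6

/-! ### The Hodge star as an iterated contraction. -/

theorem hodgeStar_add (w : Fin 7 → ℝ) (vol α β : Form) :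
    hodgeStar w vol (α + β) = hodgeStar w vol α + hodgeStar w vol β := by
  simp [hodgeStar]

theorem hodgeStar_sub (w : Fin 7 → ℝ) (vol α β : Form) :
    hodgeStar w vol (α - β) = hodgeStar w vol α - hodgeStar w vol β := by
  simp [hodgeStar]

theorem hodgeStar_neg (w : Fin 7 → ℝ) (vol α : Form) :
    hodgeStar w vol (-α) = -hodgeStar w vol α := by
  simp [hodgeStar]

theorem hodgeStar_smul (w : Fin 7 → ℝ) (vol : Form) (c : ℝ) (α : Form) :
    hodgeStar w vol (c • α) = c • hodgeStar w vol α := by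
  simp [hodgeStar]

theorem hodgeStar_smul_left (w : Fin 7 → ℝ) (vol : Form) (c : ℝ) (α : Form) :
    hodgeStar w (c • vol) α = c • hodgeStar w vol α := by
  simp [hodgeStar]

/-- The reversal in the definition makes the leftmost covector act first on the volume form, so the
star is computed one factor at a time. -/
theorem hodgeStar_ι_mul (w : Fin 7 → ℝ) (vol α : Form) (a : Fin 7 → ℝ) :
    hodgeStar w vol (ExteriorAlgebra.ι ℝ a * α) =
      hodgeStar w (CliffordAlgebra.contractLeft (sharp w a) vol) α := by
  unfold hodgeStar
  rw [CliffordAlgebra.reverse.map_mul, map_mul]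
  erw [CliffordAlgebra.reverse_ι, ExteriorAlgebra.lift_ι_apply]
  rfl

theorem hodgeStar_e_mul (w : Fin 7 → ℝ) (vol : Form) (n : ℕ) (α : Form) :
    hodgeStar w vol (e n * α) = hodgeStar w (contr w n vol) α :=
  hodgeStar_ι_mul w vol α _

theorem hodgeStar_algebraMap (w : Fin 7 → ℝ) (vol : Form) (c : ℝ) :
    hodgeStar w vol (algebraMap ℝ Form c) = c • vol := by
  unfold hodgeStar
  erw [CliffordAlgebra.reverse.commutes, AlgHom.commutes]
  rfl

theorem hodgeStar_e (w : Fin 7 → ℝ) (vol : Form) (n : ℕ) :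
    hodgeStar w vol (e n) = contr w n vol := by
  have h := hodgeStar_e_mul w vol n 1
  rw [mul_one] at h
  rw [h, hodgeStar, CliffordAlgebra.reverse.map_one, map_one]
  rfl

/-! ### Explicit wedge products and stars. -/

theorem twoForm_eq (B : Fin 7 → Fin 7 → ℝ) : twoForm B =
    B 0 1 • (e 1 * e 2) + B 0 2 • (e 1 * e 3) + B 0 3 • (e 1 * e 4) + B 0 4 • (e 1 * e 5) +
    B 0 5 • (e 1 * e 6) + B 0 6 • (e 1 * e 7) + B 1 2 • (e 2 * e 3) + B 1 3 • (e 2 * e 4) +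
    B 1 4 • (e 2 * e 5) + B 1 5 • (e 2 * e 6) + B 1 6 • (e 2 * e 7) + B 2 3 • (e 3 * e 4) +
    B 2 4 • (e 3 * e 5) + B 2 5 • (e 3 * e 6) + B 2 6 • (e 3 * e 7) + B 3 4 • (e 4 * e 5) +
    B 3 5 • (e 4 * e 6) + B 3 6 • (e 4 * e 7) + B 4 5 • (e 5 * e 6) + B 4 6 • (e 5 * e 7) +
    B 5 6 • (e 6 * e 7) := by
  have h : ∀ p : Fin 7, Finset.Ioi p = Finset.univ.filter (p < ·) := fun p => by ext; simp
  simp [twoForm, h, Finset.sum_filter, Fin.sum_univ_seven]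
  abel

theorem volForm_eq (w : Fin 7 → ℝ) :
    volForm w = √(∏ i, w i) • (e 1 * (e 2 * (e 3 * (e 4 * (e 5 * (e 6 * e 7)))))) := by
  simp only [volForm, mul_assoc]

/-- The factor `v` is left free to absorb both the volume density and the sign of z. -/
theorem g2Dual_eq (a b x y z : ℝ) {w : Fin 7 → ℝ} {y₁ y₂ y₃ : ℝ} (hw : w = weights y₁ y₂ y₃)
    (v : ℝ) :
    hodgeStar w (v • (e 1 * (e 2 * (e 3 * (e 4 * (e 5 * (e 6 * e 7)))))))
      (g2Form a b x y z) =
    v • (-(z * y₁⁻¹ * y₂⁻¹ * y₃⁻¹) • (e 2 * (e 3 * (e 5 * e 6)) + e 2 * (e 4 * (e 5 * e 7))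
          + e 3 * (e 4 * (e 6 * e 7)))
      + (b * y₂⁻¹ * y₂⁻¹ * y₃⁻¹) • (e 1 * (e 4 * (e 5 * e 6)) - e 1 * (e 3 * (e 5 * e 7))
          + e 1 * (e 2 * (e 6 * e 7)))
      + (a * y₂⁻¹ * y₃⁻¹ * y₃⁻¹) • (e 1 * (e 3 * (e 4 * e 5)) - e 1 * (e 2 * (e 4 * e 6))
          + e 1 * (e 2 * (e 3 * e 7)))
      - (x * y₂⁻¹ * y₂⁻¹ * y₂⁻¹) • (e 1 * (e 5 * (e 6 * e 7)))
      - (y * y₃⁻¹ * y₃⁻¹ * y₃⁻¹) • (e 1 * (e 2 * (e 3 * e 4)))) := by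
  subst hw
  rw [hodgeStar_smul_left]
  congr 1
  simp [g2Form, mul_add, hodgeStar_add, hodgeStar_sub, hodgeStar_smul, hodgeStar_neg,
    mul_assoc, hodgeStar_e_mul, hodgeStar_e, contr_e_mul, contr_e, inner_one, inner_two,
    inner_three, inner_four, inner_five, inner_six, inner_seven, inner_ne]
  simp only [weights, Matrix.cons_val]
  module

/-- Each term of ψ containing e¹ has one index from each of the pairs 25, 36, 47, so it is killed.
Each of the three other terms omits exactly one pair, which gives the factor 3. -/
theorem e_two_five_mul_g2Dual (a b x y z : ℝ) {w : Fin 7 → ℝ} {y₁ y₂ y₃ : ℝ}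
    (hw : w = weights y₁ y₂ y₃) (v : ℝ) :
    (e 2 * e 5 + e 3 * e 6 + e 4 * e 7) *
      hodgeStar w (v • (e 1 * (e 2 * (e 3 * (e 4 * (e 5 * (e 6 * e 7)))))))
        (g2Form a b x y z) =
      (-3 * (v * (z * y₁⁻¹ * y₂⁻¹ * y₃⁻¹))) • (e 2 * (e 3 * (e 4 * (e 5 * (e 6 * e 7))))) := by
  rw [g2Dual_eq a b x y z hw]
  simp [mul_add, add_mul, mul_sub, mul_assoc, e_mul_self, e_mul_self_mul, e_mul_swap,
    e_mul_swap_mul]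
  module

/-- The forms `e²³ + e⁵⁶`, `e²⁴ + e⁵⁷`, `e³⁴ + e⁶⁷`. -/
def canonicalForm : Fin 3 → Form :=
  ![e 2 * e 3 + e 5 * e 6, e 2 * e 4 + e 5 * e 7, e 3 * e 4 + e 6 * e 7]

/-- With x = a, y = b and y₂ = y₃ the surviving products cancel in pairs: an a-term against the
x-term, a b-term against the y-term. -/
theorem canonicalForm_mul_g2Dual (a b z : ℝ) {w : Fin 7 → ℝ} {y₁ y₂ : ℝ}
    (hw : w = weights y₁ y₂ y₂) (v : ℝ) (k : Fin 3) :
    canonicalForm k *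
      hodgeStar w (v • (e 1 * (e 2 * (e 3 * (e 4 * (e 5 * (e 6 * e 7)))))))
        (g2Form a b a b z) = 0 := by
  rw [g2Dual_eq a b a b z hw]
  fin_cases k <;>
    simp [canonicalForm, mul_add, add_mul, mul_sub, mul_assoc, e_mul_self, e_mul_self_mul,
      e_mul_swap, e_mul_swap_mul]

theorem e_two_to_seven_ne_zero : e 2 * (e 3 * (e 4 * (e 5 * (e 6 * e 7)))) ≠ 0 := by
  intro h
  -- With all weights 1, contracting the factors from left to right leaves the scalar 1.
  have h' := congrArg (fun x => contr 1 7 (contr 1 6 (contr 1 5 (contr 1 4 (contr 1 3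
    (contr 1 2 x)))))) h
  simp [contr_e_mul, contr_e, inner_ne, inner_two, inner_three, inner_four, inner_five, inner_six,
    inner_seven] at h'

/-- On primitive (1,1)-forms, ω ∧ · followed by the star is a multiple of the identity. The sign is
positive because (e²⁵ + e³⁶ + e⁴⁷)³ is a negative multiple of e²³⁴⁵⁶⁷. -/
theorem hodgeStar_canonicalForm {w : Fin 7 → ℝ} {y₁ y₂ : ℝ} (hw : w = weights y₁ y₂ y₂)
    (v : ℝ) (k : Fin 3) :
    hodgeStar w (v • (e 1 * (e 2 * (e 3 * (e 4 * (e 5 * (e 6 * e 7)))))))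
      (e 1 * (e 2 * e 5 + e 3 * e 6 + e 4 * e 7) * canonicalForm k) =
    (v * (y₁⁻¹ * y₂⁻¹ * y₂⁻¹ * y₂⁻¹ * y₂⁻¹)) • canonicalForm k := by
  subst hw
  rw [hodgeStar_smul_left, mul_smul]
  congr 1
  fin_cases k <;>
  · simp [canonicalForm, mul_add, add_mul, hodgeStar_add, hodgeStar_neg,
      mul_assoc, e_mul_self, e_mul_self_mul, e_mul_swap, e_mul_swap_mul,
      hodgeStar_e_mul, hodgeStar_e, contr_e_mul, contr_e, inner_one,
      inner_two, inner_three, inner_four, inner_five, inner_six, inner_seven, inner_ne]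
    simp only [weights, Matrix.cons_val]
    module

/-- Contractions anticommute, so a vector that annihilates the volume argument annihilates
everything contracted out of it. -/
theorem contr_hodgeStar (w : Fin 7 → ℝ) (n : ℕ) (β : Form) :
    ∀ vol, contr w n vol = 0 → contr w n (hodgeStar w vol β) = 0 := by
  induction β using CliffordAlgebra.left_induction with
  | algebraMap c =>
    intro vol h
    erw [hodgeStar_algebraMap]
    rw [map_smul, h, smul_zero]
  | add α β hα hβ =>
    intro vol h
    rw [hodgeStar_add, map_add, hα vol h, hβ vol h, add_zero]
  | ι_mul β m hβ =>
    intro vol h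
    erw [hodgeStar_ι_mul]
    refine hβ _ ?_
    unfold contr at h ⊢
    erw [CliffordAlgebra.contractLeft_comm, h, map_zero, neg_zero]

theorem contr_hodgeStar_e_mul (w : Fin 7 → ℝ) (n : ℕ) (vol β : Form) :
    contr w n (hodgeStar w vol (e n * β)) = 0 := by
  rw [hodgeStar_e_mul]
  exact contr_hodgeStar w n β _ (CliffordAlgebra.contractLeft_contractLeft _ _)

theorem twoForm_zero_left {w : Fin 7 → ℝ} (hw : w 0 ≠ 0) {B : Fin 7 → Fin 7 → ℝ}
    (h : contr w 1 (twoForm B) = 0) (q : Fin 7) (hq : q ≠ 0) : B 0 q = 0 := by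
  -- Contracting with e₁ leaves a 1-form proportional to ∑ B 0 q e^q; a second contraction, with
  -- weights 1, reads off one coefficient.
  have h1 := congrArg (contr 1 (q + 1)) h
  rw [twoForm_eq] at h1
  fin_cases q
  · exact absurd rfl hq
  all_goals
    simpa [contr_e_mul, contr_e, contr_one, inner_ne, inner_one, inner_two, inner_three, inner_four,
      inner_five, inner_six, inner_seven, hw] using h1

/-! ### Equivariant linear maps -/

/-- The rotation by `π` about the `k`-th axis. -/
def halfTurn (k : Fin 3) : SO 3 :=
  ⟨Matrix.diagonal (fun i => if i = k then 1 else -1), by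
    rw [Matrix.mem_specialOrthogonalGroup_iff, Matrix.mem_orthogonalGroup_iff]
    constructor
    · ext i j
      fin_cases k <;> fin_cases i <;> fin_cases j <;> simp
    · rw [Matrix.det_diagonal]
      fin_cases k <;> simp [Fin.prod_univ_three]⟩

theorem Ad_halfTurn_apply (k : Fin 3) (W : so 3) (i j : Fin 3) :
    (Ad (halfTurn k) W).1 i j =
      (if i = k then 1 else -1) * W.1 i j * (if j = k then 1 else -1) := by
  simp [coe_Ad, halfTurn]

/-- The half-turn about axis i changes the sign of every off-diagonal entry in row i. -/
theorem eq_zero_of_Ad_eq_self {W : so 3} (h : ∀ r : SO 3, Ad r W = W) : W = 0 := by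
  apply Subtype.ext
  ext i j
  by_cases hij : j = i
  · subst hij
    exact so_apply_self W j
  · have h1 := Ad_halfTurn_apply i W i j
    rw [h] at h1
    simp only [hij, if_true, if_false] at h1
    change W.1 i j = 0
    linarith

theorem incl_halfTurn (k : Fin 3) : (incl (halfTurn k)).1 =
    Matrix.diagonal (![1, 1, if 0 = k then 1 else -1, if 1 = k then 1 else -1,
      if 2 = k then 1 else -1] : Fin 5 → ℝ) := by
  rw [incl_apply]
  ext i j
  fin_cases i <;> fin_cases j <;> simp [halfTurn]

theorem Ad_skew_of_diagonal {n : ℕ} (g : SO n) (d : Fin n → ℝ) (h : g.1 = Matrix.diagonal d)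
    (i j : Fin n) : Ad g (skew i j) = (d i * d j) • skew i j := by
  apply Subtype.ext
  ext k l
  change _ = d i * d j * (skew i j).1 k l
  rw [coe_Ad, h]
  simp only [Matrix.diagonal_transpose, Matrix.mul_diagonal, Matrix.diagonal_mul, skew_apply]
  split_ifs with h1 h2 h2
  · obtain ⟨rfl, rfl⟩ := h1; ring
  · obtain ⟨rfl, rfl⟩ := h1; ring
  · obtain ⟨rfl, rfl⟩ := h2; ring
  · ring

theorem Ad_incl_frame_zero (r : SO 3) : Ad (incl r) (frame 0) = frame 0 := by
  apply Subtype.ext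
  change (Ad (incl r) (skew 0 1)).1 = (skew 0 1 : so 5).1
  ext i j
  simp only [coe_Ad, Matrix.mul_apply, Matrix.transpose_apply, Fin.sum_univ_five, skew_apply]
  rw [incl_apply]
  fin_cases i <;> fin_cases j <;> simp

theorem exists_Ad_frame_eq_neg (p : Fin 7) (hp : p ≠ 0) :
    ∃ r : SO 3, Ad (incl r) (frame p) = -frame p := by
  have key : ∀ k : Fin 3, ∀ i j : Fin 5,
      (![1, 1, if 0 = k then 1 else -1, if 1 = k then 1 else -1,
      if 2 = k then 1 else -1] : Fin 5 → ℝ) i * (![1, 1, if 0 = k then 1 else -1,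
      if 1 = k then 1 else -1, if 2 = k then 1 else -1] : Fin 5 → ℝ) j = -1 →
      ∃ r : SO 3, Ad (incl r) (skew i j) = -skew i j := fun k i j h =>
    ⟨halfTurn k, by rw [Ad_skew_of_diagonal _ _ (incl_halfTurn k), h, neg_one_smul]⟩
  fin_cases p
  · exact absurd rfl hp
  -- The axis must differ from the one to which the frame vector corresponds; the next axis in
  -- cyclic order is used.
  · exact key 1 0 2 (by simp)
  · exact key 2 0 3 (by simp)
  · exact key 0 0 4 (by simp)
  · exact key 1 1 2 (by simp)
  · exact key 2 1 3 (by simp)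
  · exact key 0 1 4 (by simp)

theorem self_eq_neg_iff {W : so 3} : W = -W ↔ W = 0 := by
  refine ⟨fun h => ?_, fun h => by simp [h]⟩
  apply Subtype.ext
  ext i j
  exact self_eq_neg.1 (congrArg (entry i j) h)

namespace Connection

theorem IsInvariant.eq_linearConnection_of_linearPart_eq {φ : SO 3 →* SO 3} {A : Connection φ}
    (hA : A.IsInvariant) {Λ : so 5 →ₗ[ℝ] so 3} (h : A.linearPart = Λ) (h1 h2) :
    A = linearConnection φ Λ h1 h2 := by
  subst h
  exact hA.eq_linearConnection

/-- Since Ad ∘ φ is trivial, Λ takes the same value on a frame vector and on its negative, except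
for the isotropy-fixed e₁. -/
theorem IsInvariant.eq_trivialConnection {A : Connection phi0} (hA : A.IsInvariant) :
    ∃ c : Fin 3 → ℝ, A = trivialConnection c := by
  have h0 : ∀ p : Fin 7, p ≠ 0 → A.linearPart (frame p) = 0 := fun p hp => by
    obtain ⟨r, hr⟩ := exists_Ad_frame_eq_neg p hp
    have h := hA.linearPart_Ad r (frame p)
    rw [hr, map_neg, MonoidHom.one_apply, Ad_one] at h
    exact self_eq_neg_iff.1 h.symm
  have hW : ∀ W, A.linearPart (inclLie W) = 0 := fun W =>
    hA.linearPart_inclLie W 0 fun i j => by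
      simpa using hasDerivAt_const (0 : ℝ) ((1 : SO 3).1 i j)
  refine ⟨![(A.linearPart (frame 0)).1 0 1, (A.linearPart (frame 0)).1 0 2,
      (A.linearPart (frame 0)).1 1 2],
    hA.eq_linearConnection_of_linearPart_eq (LinearMap.ext fun X => ?_) _ _⟩
  rw [← so_three_eq_sum]
  conv_lhs => rw [eq_sum_mCoord_add_inclLie X]
  rw [map_add, map_sum, hW, add_zero, Finset.sum_eq_single 0]
  · rw [map_smul]
    rfl
  · intro p _ hp
    rw [map_smul, h0 p hp, smul_zero]
  · simp

theorem IsInvariant.eq_canonicalConnection {A : Connection phi1} (hA : A.IsInvariant)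
    (h : ∀ p, A.linearPart (frame p) = 0) : A = canonicalConnection := by
  refine hA.eq_linearConnection_of_linearPart_eq (LinearMap.ext fun X => ?_) _ _
  conv_lhs => rw [eq_sum_mCoord_add_inclLie X]
  rw [map_add, map_sum, hA.linearPart_inclLie _ _ (isVelocity_id _)]
  simp [h]

end Connection

/-! ### Curvature forms -/

theorem lie_frame_zero_left : (∀ k : Fin 3,
    ⁅frame 0, (![frame 1, frame 2, frame 3] : Fin 3 → so 5) k⁆ =
      -(![frame 4, frame 5, frame 6] : Fin 3 → so 5) k) ∧ ∀ k : Fin 3,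
    ⁅frame 0, (![frame 4, frame 5, frame 6] : Fin 3 → so 5) k⁆ =
      (![frame 1, frame 2, frame 3] : Fin 3 → so 5) k := by
  constructor <;> intro k <;> fin_cases k <;> simp [frame, lie_skew_skew]

theorem coord1_skew (i j : Fin 5) : coord1 (skew i j) =
    (if i = 0 ∧ j = 1 then 1 else 0) - if j = 0 ∧ i = 1 then 1 else 0 := skew_apply i j 0 1

theorem projLie_zero_skew (j : Fin 5) : projLie (skew 0 j) = 0 := by
  apply Subtype.ext
  ext k l
  change (skew 0 j).1 (Fin.natAdd 2 k) (Fin.natAdd 2 l) = 0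
  fin_cases k <;> fin_cases l <;> simp [skew_apply]

theorem projLie_one_skew (j : Fin 5) : projLie (skew 1 j) = 0 := by
  apply Subtype.ext
  ext k l
  change (skew 1 j).1 (Fin.natAdd 2 k) (Fin.natAdd 2 l) = 0
  fin_cases k <;> fin_cases l <;> simp [skew_apply]

theorem projLie_skew_two_three : projLie (skew 2 3) = soBasis 0 := projLie_skew 0 1
theorem projLie_skew_two_four : projLie (skew 2 4) = soBasis 1 := projLie_skew 0 2
theorem projLie_skew_three_four : projLie (skew 3 4) = soBasis 2 := projLie_skew 1 2

theorem linearConnection_curvatureForm (φ : SO 3 →* SO 3) (Λ : so 5 →ₗ[ℝ] so 3) (h1 h2)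
    (u : SO 5) (s : SO 3) (i j : Fin 3) :
    (linearConnection φ Λ h1 h2).curvatureForm u s i j = twoForm fun p q =>
      (Ad s⁻¹ (⁅Λ (frame p), Λ (frame q)⁆ - Λ ⁅frame p, frame q⁆)).1 i j := by
  simp only [Connection.curvatureForm, linearConnection_curvature]

theorem canonicalConnection_curvatureForm (u : SO 5) (s : SO 3) (i j : Fin 3) :
    canonicalConnection.curvatureForm u s i j =
      ∑ k, (Ad s⁻¹ (soBasis k)).1 i j • canonicalForm k := by
  rw [canonicalConnection, linearConnection_curvatureForm, twoForm_eq]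
  simp only [projLie_frame, lie_zero, zero_sub]
  simp [frame, lie_skew_skew, projLie_zero_skew, projLie_one_skew, projLie_skew_two_three,
    projLie_skew_two_four, projLie_skew_three_four, Fin.sum_univ_three, canonicalForm]
  abel

/-- The image of Λ is spanned by one element, so [ΛX, ΛY] = 0 and only -e¹([X, Y]) T is left. -/
theorem trivialConnection_curvatureForm (c : Fin 3 → ℝ) (u : SO 5) (s : SO 3) (i j : Fin 3) :
    (trivialConnection c).curvatureForm u s i j =
      (Ad s⁻¹ (∑ k, c k • soBasis k)).1 i j • (e 2 * e 5 + e 3 * e 6 + e 4 * e 7) := by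
  rw [trivialConnection, linearConnection_curvatureForm, twoForm_eq]
  generalize (∑ k, c k • soBasis k) = T
  simp only [LinearMap.smulRight_apply, smul_lie, lie_smul, lie_self, smul_zero, zero_sub]
  simp [frame, lie_skew_skew, coord1_skew]

theorem dOneForm_eq (c : ℝ) :
    dOneForm (Pi.single 0 c) = c • (e 2 * e 5 + e 3 * e 6 + e 4 * e 7) := by
  have h : ∀ X : so 5, ∑ k, (Pi.single 0 c : Fin 7 → ℝ) k * mCoord X k = c * coord1 X :=
    fun X => by
      rw [Finset.sum_eq_single 0]
      · rw [Pi.single_eq_same]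
        rfl
      · intro k _ hk
        rw [Pi.single_eq_of_ne hk, zero_mul]
      · simp
  simp only [dOneForm, h]
  rw [twoForm_eq]
  simp [frame, lie_skew_skew, coord1_skew]

theorem oneForm_single_zero (c : ℝ) : oneForm (Pi.single 0 c) = c • e 1 := by
  have h : (Pi.single 0 c : Fin 7 → ℝ) =
      c • fun k : Fin 7 => if (k : ℕ) + 1 = 1 then (1 : ℝ) else 0 := by
    ext k
    fin_cases k <;> simp
  rw [oneForm, h]
  exact map_smul _ _ _

/-! ### The instanton equations -/

theorem g2Dual_eq_hodgeStar (a b x y z : ℝ) : g2Dual a b x y z =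
    hodgeStar (g2Weights a b x y z)
      ((Real.sign z * √(∏ i, g2Weights a b x y z i)) •
        (e 1 * (e 2 * (e 3 * (e 4 * (e 5 * (e 6 * e 7))))))) (g2Form a b x y z) := by
  rw [g2Dual, volForm_eq, smul_smul]

theorem metricY2_pos {a b x y : ℝ} (h₁ : 0 < a ^ 2 + b * y) (h₂ : 0 < b ^ 2 + a * x) :
    0 < metricY2 a b x y :=
  div_pos (Real.rpow_pos_of_pos h₂ _) (Real.rpow_pos_of_pos h₁ _)

theorem metricY3_pos {a b x y : ℝ} (h₁ : 0 < a ^ 2 + b * y) (h₂ : 0 < b ^ 2 + a * x) :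
    0 < metricY3 a b x y :=
  div_pos (Real.rpow_pos_of_pos h₁ _) (Real.rpow_pos_of_pos h₂ _)

theorem metricY1_pos {a b x y z : ℝ} (h₁ : 0 < a ^ 2 + b * y) (h₂ : 0 < b ^ 2 + a * x)
    (hz : z ≠ 0) : 0 < metricY1 a b x y z :=
  div_pos (by positivity) (mul_pos (metricY2_pos h₁ h₂) (metricY3_pos h₁ h₂))

theorem metricY3_self (a b : ℝ) : metricY3 a b a b = metricY2 a b a b := by
  have h : a ^ 2 + b * b = b ^ 2 + a * a := by ring
  rw [metricY3, metricY2, h]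

theorem metricY2_self {a b : ℝ} (h : 0 < a ^ 2 + b ^ 2) :
    metricY2 a b a b = (a ^ 2 + b ^ 2) ^ (1 / 3 : ℝ) := by
  have h₁ : a ^ 2 + b * b = a ^ 2 + b ^ 2 := by ring
  have h₂ : b ^ 2 + a * a = a ^ 2 + b ^ 2 := by ring
  rw [metricY2, h₁, h₂, ← Real.rpow_sub h]
  norm_num

theorem metricY2_self_pos {a b : ℝ} (h : 0 < a ^ 2 + b ^ 2) : 0 < metricY2 a b a b := by
  rw [metricY2_self h]
  positivity

theorem metricY1_self {a b z : ℝ} (h : 0 < a ^ 2 + b ^ 2)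
    (hz : z ^ 2 = 4 * (a ^ 2 + b ^ 2) ^ (4 / 3 : ℝ)) :
    metricY1 a b a b z = 4 * metricY2 a b a b ^ 2 := by
  have h₁ : (a ^ 2 + b ^ 2) ^ (4 / 3 : ℝ) = metricY2 a b a b ^ 4 := by
    rw [metricY2_self h, ← Real.rpow_mul_natCast h.le]
    norm_num
  have h₂ := metricY2_self_pos h
  rw [metricY1, metricY3_self, hz, h₁]
  field_simp

theorem canonicalConnection_isG2Instanton (a b z : ℝ) :
    canonicalConnection.IsG2Instanton a b a b z := by
  intro u s i j
  have hw : g2Weights a b a b z =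
      weights (metricY1 a b a b z) (metricY2 a b a b) (metricY2 a b a b) := by
    rw [g2Weights, metricY3_self]
  rw [canonicalConnection_curvatureForm, g2Dual_eq_hodgeStar, Finset.sum_mul]
  refine Finset.sum_eq_zero fun k _ => ?_
  rw [smul_mul_assoc, canonicalForm_mul_g2Dual a b z hw, smul_zero]

theorem sdci_source_eq (c : ℝ) (F : Form) :
    oneForm (Pi.single 0 c) * ((1 / 2 : ℝ) • dOneForm (Pi.single 0 c)) * F =
      (c * c / 2) • (e 1 * (e 2 * e 5 + e 3 * e 6 + e 4 * e 7) * F) := by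
  rw [oneForm_single_zero, dOneForm_eq]
  simp only [smul_mul_assoc, mul_smul_comm, smul_smul]
  congr 1
  ring

theorem canonicalConnection_isSDCI {y₂ : ℝ} (h : 0 < y₂) :
    canonicalConnection.IsSDCI (4 * y₂ ^ 2) y₂ y₂ := by
  intro u s i j
  have h₁ : √(4 * y₂ ^ 2) * √(4 * y₂ ^ 2) = 4 * y₂ ^ 2 := Real.mul_self_sqrt (by positivity)
  have h₂ : √(∏ i, weights (4 * y₂ ^ 2) y₂ y₂ i) = 2 * y₂ ^ 4 := by
    rw [← Real.sqrt_sq (by positivity : 0 ≤ 2 * y₂ ^ 4)]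
    congr 1
    simp [weights, Fin.prod_univ_seven]
    ring
  have h₃ : ∀ k, (4 * y₂ ^ 2 / 2) • hodgeStar (weights (4 * y₂ ^ 2) y₂ y₂)
      ((2 * y₂ ^ 4) • (e 1 * (e 2 * (e 3 * (e 4 * (e 5 * (e 6 * e 7)))))))
      (e 1 * (e 2 * e 5 + e 3 * e 6 + e 4 * e 7) * canonicalForm k) = canonicalForm k := by
    intro k
    rw [hodgeStar_canonicalForm rfl, smul_smul]
    -- The scalar is (y₁/2) · 2y₂⁴ / (y₁ y₂⁴), which is 1 for y₁ = 4y₂²... after cancelling: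
    -- (2y₂²)(2y₂⁴) / (4y₂⁶) = 1.
    convert one_smul ℝ (canonicalForm k) using 2
    field_simp
  rw [sdci_source_eq, canonicalConnection_curvatureForm, volForm_eq, h₁, h₂, Finset.mul_sum]
  simp only [Fin.sum_univ_three, hodgeStar_add, mul_smul_comm, hodgeStar_smul, smul_add]
  simp only [smul_comm (4 * y₂ ^ 2 / 2), h₃]

/-- The curvature is the star of a multiple of e¹, and such a star is annihilated by contraction
with e₁. -/
theorem Connection.IsSDCI.curvature_frame_zero {φ : SO 3 →* SO 3} {A : Connection φ}
    {y₁ y₂ y₃ : ℝ} (h : A.IsSDCI y₁ y₂ y₃) (hy : y₁ ≠ 0) (u : SO 5) (s : SO 3) (q : Fin 7)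
    (hq : q ≠ 0) : A.curvature u s (frame 0, 0) (frame q, 0) = 0 := by
  ext i j
  refine twoForm_zero_left (w := weights y₁ y₂ y₃)
    (B := fun p q => A.curvature u s (frame p, 0) (frame q, 0) i j) hy ?_ q hq
  change contr _ 1 (A.curvatureForm u s i j) = 0
  rw [← h u s i j, sdci_source_eq, hodgeStar_smul, map_smul, mul_assoc, contr_hodgeStar_e_mul,
    smul_zero]

theorem Connection.IsInvariant.eq_canonicalConnection_of_isSDCI {A : Connection phi1}
    (hA : A.IsInvariant) {y₁ y₂ y₃ : ℝ} (h : A.IsSDCI y₁ y₂ y₃) (hy : y₁ ≠ 0) :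
    A = canonicalConnection := by
  have h0 : A.linearPart (frame 0) = 0 := eq_zero_of_Ad_eq_self fun r => by
    have := hA.linearPart_Ad r (frame 0)
    rw [Ad_incl_frame_zero] at this
    exact this.symm
  -- As Λ(e₁) = 0, the curvature on (e₁, e_q) is just -Λ[e₁, e_q].
  have h1 : ∀ q : Fin 7, q ≠ 0 → A.linearPart ⁅frame 0, frame q⁆ = 0 := fun q hq => by
    have := h.curvature_frame_zero hy 1 1 q hq
    rw [hA.curvature_eq, h0, zero_lie, inv_one, Ad_one, zero_sub] at this
    exact neg_eq_zero.1 (Subtype.ext this)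
  refine hA.eq_canonicalConnection fun p => ?_
  fin_cases p
  · exact h0
  · simpa using (congrArg A.linearPart (lie_frame_zero_left.2 0)).symm.trans (h1 4 (by decide))
  · simpa using (congrArg A.linearPart (lie_frame_zero_left.2 1)).symm.trans (h1 5 (by decide))
  · simpa using (congrArg A.linearPart (lie_frame_zero_left.2 2)).symm.trans (h1 6 (by decide))
  · simpa using (congrArg A.linearPart (lie_frame_zero_left.1 0)).symm.trans (h1 1 (by decide))
  · simpa using (congrArg A.linearPart (lie_frame_zero_left.1 1)).symm.trans (h1 2 (by decide))
  · simpa using (congrArg A.linearPart (lie_frame_zero_left.1 2)).symm.trans (h1 3 (by decide))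

theorem Connection.IsFlat.isG2Instanton {φ : SO 3 →* SO 3} {A : Connection φ} (h : A.IsFlat)
    (a b x y z : ℝ) : A.IsG2Instanton a b x y z := fun u s i j => by
  have h0 : A.curvatureForm u s i j = 0 := by
    simp [Connection.curvatureForm, h u s, twoForm]
  rw [h0, zero_mul]

theorem trivialConnection_isFlat {c : Fin 3 → ℝ} (h : ∑ k, c k • soBasis k = 0) :
    (trivialConnection c).IsFlat := by
  intro u s ξ ζ
  -- The form is the Maurer–Cartan form of the structure group, whose structure equation is
  -- flatness.
  have hf : ∀ u s ξ, (trivialConnection c).form u s ξ = ξ.2 := fun u s ξ => by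
    change Ad s⁻¹ (coord1 ξ.1 • ∑ k, c k • soBasis k) + ξ.2 = ξ.2
    simp [h]
  ext i j
  simp [Connection.curvature, Connection.dirDeriv, hf, Ring.lie_def]

theorem trivialConnection_isG2Instanton_iff (c : Fin 3 → ℝ) {a b x y z : ℝ}
    (h : IsG2Param a b x y z) :
    (trivialConnection c).IsG2Instanton a b x y z ↔ (trivialConnection c).IsFlat := by
  refine ⟨fun hc => trivialConnection_isFlat ?_, fun hc => hc.isG2Instanton a b x y z⟩
  obtain ⟨h₁, h₂, hz, -⟩ := h
  have hy₁ := metricY1_pos h₁ h₂ hz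
  have hy₂ := metricY2_pos h₁ h₂
  have hy₃ := metricY3_pos h₁ h₂
  have hv : √(∏ i, g2Weights a b x y z i) ≠ 0 := by
    rw [g2Weights]
    refine (Real.sqrt_pos.2 (Finset.prod_pos fun i _ => ?_)).ne'
    fin_cases i <;> assumption
  have hs : Real.sign z ≠ 0 := Real.sign_eq_zero_iff.not.2 hz
  apply Subtype.ext
  ext i j
  have h0 := hc 1 1 i j
  rw [trivialConnection_curvatureForm, smul_mul_assoc, g2Dual_eq_hodgeStar,
    e_two_five_mul_g2Dual a b x y z (w := g2Weights a b x y z) rfl, smul_smul, smul_eq_zero,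
    inv_one, Ad_one] at h0
  refine (mul_eq_zero.1 (h0.resolve_right e_two_to_seven_ne_zero)).resolve_right ?_
  have := hy₁.ne'
  have := hy₂.ne'
  have := hy₃.ne'
  positivity

end

end Stiefel

theorem mainTheorem6 :
    (∀ a b z : ℝ, 0 < a ^ 2 + b ^ 2 → z ^ 2 = 4 * (a ^ 2 + b ^ 2) ^ (4 / 3 : ℝ) →
      (Stiefel.canonicalConnection.IsInvariant ∧
        Stiefel.canonicalConnection.IsG2Instanton a b a b z ∧
        Stiefel.canonicalConnection.IsSDCI (Stiefel.metricY1 a b a b z)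
          (Stiefel.metricY2 a b a b) (Stiefel.metricY3 a b a b)) ∧
      ∀ A : Stiefel.Connection Stiefel.phi1, A.IsInvariant →
        A.IsG2Instanton a b a b z →
        A.IsSDCI (Stiefel.metricY1 a b a b z) (Stiefel.metricY2 a b a b)
          (Stiefel.metricY3 a b a b) →
        A = Stiefel.canonicalConnection) ∧
    (∀ (u : Stiefel.SO 5) (s : Stiefel.SO 3) (i j : Fin 3),
      Stiefel.canonicalConnection.curvatureForm u s i j =
        (Stiefel.Ad s⁻¹ (Stiefel.soBasis 0)).1 i j •
            (Stiefel.e 2 * Stiefel.e 3 + Stiefel.e 5 * Stiefel.e 6) +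
          (Stiefel.Ad s⁻¹ (Stiefel.soBasis 1)).1 i j •
            (Stiefel.e 2 * Stiefel.e 4 + Stiefel.e 5 * Stiefel.e 7) +
          (Stiefel.Ad s⁻¹ (Stiefel.soBasis 2)).1 i j •
            (Stiefel.e 3 * Stiefel.e 4 + Stiefel.e 6 * Stiefel.e 7)) ∧
    (∀ c : Fin 3 → ℝ, (Stiefel.trivialConnection c).IsInvariant ∧
      ∀ (u : Stiefel.SO 5) (s : Stiefel.SO 3) (i j : Fin 3),
        (Stiefel.trivialConnection c).curvatureForm u s i j =
          (Stiefel.Ad s⁻¹ (∑ k, c k • Stiefel.soBasis k)).1 i j •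
            (Stiefel.e 2 * Stiefel.e 5 + Stiefel.e 3 * Stiefel.e 6 +
              Stiefel.e 4 * Stiefel.e 7)) ∧
    (∀ A : Stiefel.Connection Stiefel.phi0, A.IsInvariant →
      (∃ c : Fin 3 → ℝ, A = Stiefel.trivialConnection c) ∧
      ∀ a b x y z : ℝ, Stiefel.IsG2Param a b x y z →
        (A.IsG2Instanton a b x y z ↔ A.IsFlat)) := by
  refine ⟨fun a b z h hz => ?_, fun u s i j => ?_,
    fun c => ⟨Stiefel.linearConnection_isInvariant _ _ _ _,
      Stiefel.trivialConnection_curvatureForm c⟩, fun A hA => ?_⟩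
  · have hy := Stiefel.metricY2_self_pos h
    rw [Stiefel.metricY3_self, Stiefel.metricY1_self h hz]
    exact ⟨⟨Stiefel.linearConnection_isInvariant _ _ _ _,
      Stiefel.canonicalConnection_isG2Instanton a b z, Stiefel.canonicalConnection_isSDCI hy⟩,
      fun A hA _ h => hA.eq_canonicalConnection_of_isSDCI h (by positivity)⟩
  · rw [Stiefel.canonicalConnection_curvatureForm, Fin.sum_univ_three]
    rfl
  · obtain ⟨c, rfl⟩ := hA.eq_trivialConnection
    exact ⟨⟨c, rfl⟩, fun a b x y z h => Stiefel.trivialConnection_isG2Instanton_iff c h⟩
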